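/- All graphs are finite and simple. A set $D$ of vertices of a graph $G$ is a certified dominating set if every vertex outside $D$ has a neighbour in $D$ and every vertex in $D$ has either no neighbour or at least two neighbours outside $D$; $\gamma_{\rm cer}(G)$ is the minimum cardinality of such a set. The corona of a graph $H$ is the graph obtained from $H$ by attaching one new pendant vertex to each vertex of $H$. A leaf is a vertex of degree one, and a support vertex is a neighbour of a leaf. A diadem graph is a graph obtained from the corona of some graph by adding one new vertex and joining it to exactly one vertex, which is a support vertex of the corona. Theorem. Let $G$ be a graph of order $n\ge 3$. Then $\gamma_{\rm cer}(G)=n-2$ if and only if, up to isomorphism, one of the following holds: (a) $G$ is $C_3$, $C_4$, or a diadem graph; (b) $G$ is the disjoint union of $C_3$, $C_4$, or a diadem graph with $k\ge 0$ isolated vertices; (c) $G$ is the disjoint union of $C_3$, $C_4$, or a diadem graph with the corona of some graph and with $k\ge 0$ isolated vertices. -/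

import Mathlib

open SimpleGraph

universe u

namespace CertDom

/-- `D` is a certified dominating set of `G`: every vertex outside `D` has a neighbour in `D`, and
every vertex of `D` has either no neighbour or at least two neighbours outside `D`. -/
def IsCertifiedDominating {V : Type u} (G : SimpleGraph V) (D : Set V) : Prop :=
  (∀ v, v ∉ D → ∃ w ∈ D, G.Adj v w) ∧
    ∀ v ∈ D, G.neighborSet v \ D = ∅ ∨ (G.neighborSet v \ D).Nontrivial

/-- The whole vertex set is certified dominating, so the minimum below is over a nonempty set. -/
theorem isCertifiedDominating_univ {V : Type u} (G : SimpleGraph V) :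
    IsCertifiedDominating G Set.univ :=
  ⟨fun v hv => absurd (Set.mem_univ v) hv, fun _ _ => Or.inl (by simp)⟩

/-- The certified domination number: the minimum cardinality of a certified dominating set
of a finite graph. -/
noncomputable def certDomNumber {V : Type u} [Fintype V] (G : SimpleGraph V) : ℕ :=
  sInf {k | ∃ D : Finset V, IsCertifiedDominating G (D : Set V) ∧ D.card = k}

/-- The corona `H ∘ K₁`: a new vertex `Sum.inr w` is attached by one edge to each vertex
`Sum.inl w` of `H`. -/
def corona {W : Type u} (H : SimpleGraph W) : SimpleGraph (W ⊕ W) where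
  Adj x y := match x, y with
    | Sum.inl a, Sum.inl b => H.Adj a b
    | Sum.inl a, Sum.inr b => a = b
    | Sum.inr a, Sum.inl b => a = b
    | Sum.inr _, Sum.inr _ => False
  symm := ⟨by
    rintro (a | a) (b | b) h
    · exact SimpleGraph.Adj.symm h
    · exact Eq.symm h
    · exact Eq.symm h
    · exact h⟩
  loopless := ⟨by
    rintro (a | a) h
    · exact H.irrefl h
    · exact h⟩

/-- A leaf is a vertex of degree one. -/
def IsLeaf {V : Type u} (G : SimpleGraph V) (v : V) : Prop := ∃! w, G.Adj v w

/-- A support vertex is a neighbour of a leaf. -/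
def IsSupport {V : Type u} (G : SimpleGraph V) (s : V) : Prop := ∃ l, IsLeaf G l ∧ G.Adj l s

/-- The graph obtained from `G` by adding a new vertex `none` and joining it to `s` only. -/
def addPendant {V : Type u} (G : SimpleGraph V) (s : V) : SimpleGraph (Option V) where
  Adj x y := match x, y with
    | some a, some b => G.Adj a b
    | some a, none => a = s
    | none, some b => b = s
    | none, none => False
  symm := ⟨by
    rintro (_ | a) (_ | b) h
    · exact h
    · exact h
    · exact h
    · exact SimpleGraph.Adj.symm h⟩
  loopless := ⟨by
    rintro (_ | a) h
    · exact h
    · exact G.irrefl h⟩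

/-- `G` is (isomorphic to) the diadem graph of some graph `H`: a new vertex is added to the corona
of `H` and joined to a support vertex of that corona. -/
def IsDiadem {V : Type u} (G : SimpleGraph V) : Prop :=
  ∃ (W : Type u) (H : SimpleGraph W) (s : W ⊕ W), IsSupport (corona H) s ∧
    Nonempty (G ≃g addPendant (corona H) s)

/-- `G` is `C₃`, `C₄` or a diadem graph. -/
def IsC3OrC4OrDiadem {V : Type u} (G : SimpleGraph V) : Prop :=
  Nonempty (G ≃g cycleGraph 3) ∨ Nonempty (G ≃g cycleGraph 4) ∨ IsDiadem G

end CertDom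

/-!
Let a shadow be the complement `X` of a certified dominating set: every vertex of `X` has a
neighbour outside `X`, and no vertex outside `X` has exactly one neighbour in `X`. The theorem
characterises the graphs whose largest shadow has two vertices.

Call a non-isolated vertex inner if it is neither a leaf nor a support vertex. In a graph without
inner vertices a shadow consists of leaves, and with each leaf it contains a second one at the same
support vertex. Hence coronas have only the empty shadow. If there are no inner vertices and the
largest shadow has two vertices, then exactly one pair of leaves shares a support vertex, and
deleting one leaf of this pair leaves a corona and isolated vertices.

If there are inner vertices, consider the sets of inner vertices each of which has a neighbour
outside the set. Choose one of maximum size and, among those, with the fewest edges in its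
complement. Exchanging a vertex of the set for its only outside neighbour shows that every inner
vertex outside the set has at least two neighbours in it, and adding leaves at support vertices
turns the set into a shadow. If shadows have at most two vertices, it follows that the set is a
pair, that no leaves were added, and hence that inner vertices have no support neighbours and no
two leaves share a support vertex. By the maximality of the pair the inner vertices then form `C₃`
or `C₄`, and the other non-isolated vertices form a corona.
-/

namespace CertDom

variable {A B : Type*} {V : Type u}

/-- A set none of whose vertices is an enclave, i.e. has its whole closed neighbourhood in the set.
These are the complements of the dominating sets. -/
def IsEnclaveless (G : SimpleGraph A) (X : Set A) : Prop :=
  ∀ x ∈ X, ∃ w ∉ X, G.Adj x w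

/-- The complement of a certified dominating set: an enclaveless set in which no vertex outside it
has exactly one neighbour. -/
def IsShadow (G : SimpleGraph A) (X : Set A) : Prop :=
  IsEnclaveless G X ∧ ∀ v ∉ X, ∀ x ∈ X, G.Adj v x → ∃ y ∈ X, y ≠ x ∧ G.Adj v y

/-- The largest cardinality of a shadow, i.e. the order of the graph minus its certified domination
number. -/
noncomputable def shadowNumber (G : SimpleGraph A) : ℕ∞ :=
  ⨆ X : {X : Set A // IsShadow G X}, X.1.encard

theorem isCertifiedDominating_iff_isShadow_compl {G : SimpleGraph V} {D : Set V} :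
    IsCertifiedDominating G D ↔ IsShadow G Dᶜ := by
  refine and_congr (by simp [IsEnclaveless]) (forall_congr' fun v => ?_)
  rw [Set.notMem_compl_iff]
  refine imp_congr_right fun _ => ⟨fun h x hx hvx => ?_, fun h => ?_⟩
  · have hnontrivial := h.resolve_left (Set.nonempty_iff_ne_empty.1 ⟨x, hvx, hx⟩)
    obtain ⟨y, ⟨hvy, hy⟩, hyx⟩ := hnontrivial.exists_ne x
    exact ⟨y, hy, hyx, hvy⟩
  · refine (G.neighborSet v \ D).eq_empty_or_nonempty.imp_right ?_
    rintro ⟨x, hvx, hx⟩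
    obtain ⟨y, hy, hyx, hvy⟩ := h x hx hvx
    exact ⟨y, ⟨hvy, hy⟩, x, ⟨hvx, hx⟩, hyx⟩

theorem isShadow_empty (G : SimpleGraph A) : IsShadow G ∅ := by
  simp [IsShadow, IsEnclaveless]

theorem IsShadow.encard_le_shadowNumber {G : SimpleGraph A} {X : Set A} (hX : IsShadow G X) :
    X.encard ≤ shadowNumber G :=
  le_iSup (fun X : {X : Set A // IsShadow G X} => X.1.encard) ⟨X, hX⟩

theorem shadowNumber_le_iff {G : SimpleGraph A} {k : ℕ∞} :
    shadowNumber G ≤ k ↔ ∀ X, IsShadow G X → X.encard ≤ k := by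
  simp [shadowNumber]

theorem exists_isShadow_encard_eq_shadowNumber [Finite A] (G : SimpleGraph A) :
    ∃ X, IsShadow G X ∧ X.encard = shadowNumber G := by
  have : Nonempty {X : Set A // IsShadow G X} := ⟨⟨∅, isShadow_empty G⟩⟩
  obtain ⟨⟨X, hX⟩, h⟩ :=
    exists_eq_ciSup_of_finite (f := fun X : {X : Set A // IsShadow G X} => X.1.encard)
  exact ⟨X, hX, h⟩

theorem certDomNumber_add_shadowNumber [Fintype V] (G : SimpleGraph V) :
    certDomNumber G + shadowNumber G = Fintype.card V := by
  classical
  have card_add_encard_compl (D : Finset V) :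
      (D.card : ℕ∞) + (D : Set V)ᶜ.encard = Fintype.card V := by
    rw [← Set.encard_coe_eq_coe_finsetCard, Set.encard_add_encard_compl, Set.encard_univ,
      ENat.card_eq_coe_fintype_card]
  apply le_antisymm
  · obtain ⟨X, hX, hcard⟩ := exists_isShadow_encard_eq_shadowNumber G
    have hD : IsCertifiedDominating G (X.toFinsetᶜ : Finset V) := by
      simpa [isCertifiedDominating_iff_isShadow_compl] using hX
    have hle : certDomNumber G ≤ X.toFinsetᶜ.card := Nat.sInf_le ⟨_, hD, rfl⟩
    calc (certDomNumber G : ℕ∞) + shadowNumber G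
        ≤ X.toFinsetᶜ.card + ((X.toFinsetᶜ : Finset V) : Set V)ᶜ.encard := by
          gcongr
          simp [hcard]
      _ = Fintype.card V := card_add_encard_compl _
  · obtain ⟨D, hD, hcard⟩ : certDomNumber G ∈
        {k | ∃ D : Finset V, IsCertifiedDominating G (D : Set V) ∧ D.card = k} :=
      Nat.sInf_mem ⟨_, Finset.univ, by simpa using isCertifiedDominating_univ G, rfl⟩
    rw [← card_add_encard_compl D, hcard]
    gcongr
    exact (isCertifiedDominating_iff_isShadow_compl.1 hD).encard_le_shadowNumber

theorem certDomNumber_eq_card_sub_iff [Fintype V] {G : SimpleGraph V} {k : ℕ}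
    (hk : k ≤ Fintype.card V) :
    certDomNumber G = Fintype.card V - k ↔ shadowNumber G = k := by
  have hadd := certDomNumber_add_shadowNumber G
  have hfinite : shadowNumber G ≠ ⊤ := fun h => by simp [h] at hadd
  lift shadowNumber G to ℕ using hfinite with m
  norm_cast at hadd ⊢
  omega

theorem IsShadow.preimage {G : SimpleGraph A} {G' : SimpleGraph B} {X : Set B}
    (hX : IsShadow G' X) (e : G ≃g G') : IsShadow G (e ⁻¹' X) := by
  refine ⟨fun x hx => ?_, fun v hv x hx hvx => ?_⟩
  · obtain ⟨w, hw, hxw⟩ := hX.1 _ hx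
    exact ⟨e.symm w, by simpa using hw, by rw [← e.map_adj_iff]; simpa using hxw⟩
  · obtain ⟨y, hy, hyx, hvy⟩ := hX.2 (e v) hv (e x) hx (e.map_adj_iff.2 hvx)
    exact ⟨e.symm y, by simpa using hy, by simpa [RelIso.symm_apply_eq] using hyx,
      by rw [← e.map_adj_iff]; simpa using hvy⟩

theorem shadowNumber_congr {G : SimpleGraph A} {G' : SimpleGraph B} (e : G ≃g G') :
    shadowNumber G = shadowNumber G' := by
  apply le_antisymm <;> refine shadowNumber_le_iff.2 fun X hX => ?_
  · rw [← Set.encard_preimage_of_bijective e.symm.bijective]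
    exact (hX.preimage e.symm).encard_le_shadowNumber
  · rw [← Set.encard_preimage_of_bijective e.bijective]
    exact (hX.preimage e).encard_le_shadowNumber

theorem isShadow_sum_iff {G : SimpleGraph A} {G' : SimpleGraph B} {X : Set (A ⊕ B)} :
    IsShadow (G ⊕g G') X ↔ IsShadow G (Sum.inl ⁻¹' X) ∧ IsShadow G' (Sum.inr ⁻¹' X) := by
  simp only [IsShadow, IsEnclaveless, Sum.forall, Sum.exists, SimpleGraph.sum_adj,
    Set.mem_preimage, ne_eq, Sum.inl.injEq, Sum.inr.injEq, reduceCtorEq, not_false_eq_true,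
    and_false, or_false, false_or, exists_false, false_implies, implies_true, true_and, and_true]
  tauto

theorem encard_preimage_inl_add_encard_preimage_inr (X : Set (A ⊕ B)) :
    (Sum.inl ⁻¹' X).encard + (Sum.inr ⁻¹' X).encard = X.encard := by
  conv_rhs => rw [← Set.image_preimage_inl_union_image_preimage_inr X]
  rw [Set.encard_union_eq Set.disjoint_image_inl_image_inr, Sum.inl_injective.encard_image,
    Sum.inr_injective.encard_image]

theorem shadowNumber_sum (G : SimpleGraph A) (G' : SimpleGraph B) :
    shadowNumber (G ⊕g G') = shadowNumber G + shadowNumber G' := by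
  apply le_antisymm
  · refine shadowNumber_le_iff.2 fun X hX => ?_
    obtain ⟨hl, hr⟩ := isShadow_sum_iff.1 hX
    rw [← encard_preimage_inl_add_encard_preimage_inr]
    exact add_le_add hl.encard_le_shadowNumber hr.encard_le_shadowNumber
  · have : Nonempty {X : Set A // IsShadow G X} := ⟨⟨∅, isShadow_empty G⟩⟩
    have : Nonempty {X : Set B // IsShadow G' X} := ⟨⟨∅, isShadow_empty G'⟩⟩
    refine ENat.iSup_add_iSup_le fun ⟨X, hX⟩ ⟨Y, hY⟩ => ?_
    have hl : Sum.inl ⁻¹' (Sum.inl '' X ∪ Sum.inr '' Y) = X := by ext; simp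
    have hr : Sum.inr ⁻¹' (Sum.inl '' X ∪ Sum.inr '' Y) = Y := by ext; simp
    have hXY : IsShadow (G ⊕g G') (Sum.inl '' X ∪ Sum.inr '' Y) := by
      rw [isShadow_sum_iff, hl, hr]
      exact ⟨hX, hY⟩
    simpa only [← encard_preimage_inl_add_encard_preimage_inr, hl, hr]
      using hXY.encard_le_shadowNumber

theorem two_le_shadowNumber_of_twins {G : SimpleGraph A} {x y w : A} (hxy : x ≠ y)
    (htwins : ∀ v, v ≠ x → v ≠ y → (G.Adj x v ↔ G.Adj y v)) (hxw : G.Adj x w) (hwy : w ≠ y) :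
    2 ≤ shadowNumber G := by
  have hpair : IsShadow G {x, y} := by
    refine ⟨?_, fun v hv => ?_⟩
    · rintro z (rfl | rfl)
      · exact ⟨w, by simp [hxw.ne', hwy], hxw⟩
      · exact ⟨w, by simp [hxw.ne', hwy], (htwins w hxw.ne' hwy).1 hxw⟩
    · simp only [Set.mem_insert_iff, Set.mem_singleton_iff, not_or] at hv
      have hadj := htwins v hv.1 hv.2
      rintro z (rfl | rfl) hvz
      · exact ⟨y, by simp, hxy.symm, (hadj.1 hvz.symm).symm⟩
      · exact ⟨x, by simp, hxy, (hadj.2 hvz.symm).symm⟩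
  simpa only [Set.encard_pair hxy] using hpair.encard_le_shadowNumber

theorem IsShadow.eq_pair {G : SimpleGraph A} {X : Set A} {x y : A} (hX : IsShadow G X)
    (hG : shadowNumber G ≤ 2) (hx : x ∈ X) (hy : y ∈ X) (hxy : x ≠ y) : X = {x, y} := by
  refine ((Set.toFinite {x, y}).eq_of_subset_of_encard_le (Set.pair_subset hx hy) ?_).symm
  rw [Set.encard_pair hxy]
  exact hX.encard_le_shadowNumber.trans hG

theorem IsShadow.exists_common_neighbor {G : SimpleGraph A} {X : Set A} {x : A}
    (hX : IsShadow G X) (hx : x ∈ X) : ∃ y ∈ X, y ≠ x ∧ ∃ w ∉ X, G.Adj x w ∧ G.Adj y w := by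
  obtain ⟨w, hw, hxw⟩ := hX.1 x hx
  obtain ⟨y, hy, hyx, hwy⟩ := hX.2 w hw x hx hxw.symm
  exact ⟨y, hy, hyx, w, hw, hxw, hwy.symm⟩

theorem shadowNumber_cycleGraph_three : shadowNumber (cycleGraph 3) = 2 := by
  classical
  have hcard : ∀ X : Finset (Fin 3),
      (∀ x ∈ X, ∃ w, w ∉ X ∧ (cycleGraph 3).Adj x w) → X.card ≤ 2 := by decide
  refine le_antisymm (shadowNumber_le_iff.2 fun X hX => ?_)
    (two_le_shadowNumber_of_twins (x := 0) (y := 1) (w := 2) (by decide) (by decide) (by decide)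
      (by decide))
  rw [Set.encard_eq_coe_toFinset_card]
  exact_mod_cast hcard X.toFinset (by simpa [IsEnclaveless] using hX.1)

theorem shadowNumber_cycleGraph_four : shadowNumber (cycleGraph 4) = 2 := by
  classical
  have hcard : ∀ X : Finset (Fin 4),
      (∀ x ∈ X, ∃ w, w ∉ X ∧ (cycleGraph 4).Adj x w) → X.card ≤ 2 := by decide
  refine le_antisymm (shadowNumber_le_iff.2 fun X hX => ?_)
    (two_le_shadowNumber_of_twins (x := 0) (y := 2) (w := 1) (by decide) (by decide) (by decide)
      (by decide))
  rw [Set.encard_eq_coe_toFinset_card]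
  exact_mod_cast hcard X.toFinset (by simpa [IsEnclaveless] using hX.1)

/-! ### Leaves, coronas and diadem graphs -/

theorem IsLeaf.eq_of_adj {G : SimpleGraph V} {l s t : V} (h : IsLeaf G l) (hs : G.Adj l s)
    (ht : G.Adj l t) : s = t :=
  h.unique hs ht

/-- The set of leaves, for use with set operations. -/
def leaves (G : SimpleGraph V) : Set V :=
  {v | IsLeaf G v}

/-- The vertices that are neither isolated, nor leaves, nor support vertices. Here `G.support` is
Mathlib's set of non-isolated vertices and has nothing to do with support vertices. -/
def inner (G : SimpleGraph V) : Set V :=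
  {v ∈ G.support | ¬IsLeaf G v ∧ ¬IsSupport G v}

theorem IsLeaf.mem_support {G : SimpleGraph V} {l : V} (h : IsLeaf G l) : l ∈ G.support :=
  h.exists

theorem IsSupport.mem_support {G : SimpleGraph V} {s : V} (h : IsSupport G s) : s ∈ G.support :=
  let ⟨l, _, hls⟩ := h
  ⟨l, hls.symm⟩

theorem mem_inner_or_isSupport_of_adj {G : SimpleGraph V} {r v : V} (hr : r ∈ inner G)
    (hrv : G.Adj r v) : v ∈ inner G ∨ IsSupport G v :=
  or_iff_not_imp_right.2 fun hv => ⟨⟨r, hrv.symm⟩, fun hl => hr.2.2 ⟨v, hl, hrv.symm⟩, hv⟩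

theorem isLeaf_or_isSupport_of_inner_eq_empty {G : SimpleGraph V} (hG : inner G = ∅) {v : V}
    (hv : v ∈ G.support) : IsLeaf G v ∨ IsSupport G v := by
  by_contra! h
  exact hG.subset (show v ∈ inner G from ⟨hv, h⟩)

theorem nontrivial_neighborSet {G : SimpleGraph V} {v : V} (hv : v ∈ G.support)
    (hl : ¬IsLeaf G v) : (G.neighborSet v).Nontrivial := by
  refine (Set.not_subsingleton_iff).1 fun h => hl ?_
  obtain ⟨w, hw⟩ := hv
  exact ⟨w, hw, fun u hu => h hu hw⟩

theorem IsShadow.notMem_of_isSupport {G : SimpleGraph V} {X : Set V} (hX : IsShadow G X) {s : V}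
    (hs : IsSupport G s) : s ∉ X := by
  obtain ⟨l, hl, hls⟩ := hs
  intro hsX
  by_cases hlX : l ∈ X
  · obtain ⟨w, hw, hlw⟩ := hX.1 l hlX
    exact hw (hl.eq_of_adj hls hlw ▸ hsX)
  · obtain ⟨y, -, hys, hly⟩ := hX.2 l hlX s hsX hls
    exact hys (hl.eq_of_adj hly hls)

theorem IsShadow.subset_leaves {G : SimpleGraph V} {X : Set V} (hX : IsShadow G X)
    (hG : inner G = ∅) : X ⊆ leaves G := by
  intro x hx
  obtain ⟨w, -, hxw⟩ := hX.1 x hx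
  exact (isLeaf_or_isSupport_of_inner_eq_empty hG ⟨w, hxw⟩).resolve_right
    fun hs => hX.notMem_of_isSupport hs hx

theorem shadowNumber_eq_zero {G : SimpleGraph V} (hG : inner G = ∅)
    (hL : (leaves G).PairwiseDisjoint G.neighborSet) : shadowNumber G = 0 := by
  refine nonpos_iff_eq_zero.1 (shadowNumber_le_iff.2 fun X hX => ?_)
  rw [nonpos_iff_eq_zero, Set.encard_eq_zero, Set.eq_empty_iff_forall_notMem]
  intro x hx
  obtain ⟨y, hy, hyx, w, -, hxw, hyw⟩ := hX.exists_common_neighbor hx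
  exact hyx (hL.elim_set (hX.subset_leaves hG hy) (hX.subset_leaves hG hx) w hyw hxw)

theorem shadowNumber_bot : shadowNumber (⊥ : SimpleGraph A) = 0 := by
  refine nonpos_iff_eq_zero.1 (shadowNumber_le_iff.2 fun X hX => ?_)
  rw [nonpos_iff_eq_zero, Set.encard_eq_zero, Set.eq_empty_iff_forall_notMem]
  intro x hx
  obtain ⟨w, -, hxw⟩ := hX.1 x hx
  exact hxw

theorem corona_adj_inr_iff {H : SimpleGraph V} {w : V} {x : V ⊕ V} :
    (corona H).Adj (.inr w) x ↔ x = .inl w := by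
  rcases x with v | v
  · simp [corona, eq_comm]
  · simp [corona]

theorem isLeaf_corona_inr (H : SimpleGraph V) (w : V) : IsLeaf (corona H) (.inr w) := by
  simp [IsLeaf, corona_adj_inr_iff]

theorem isSupport_corona_inl (H : SimpleGraph V) (w : V) : IsSupport (corona H) (.inl w) :=
  ⟨.inr w, isLeaf_corona_inr H w, rfl⟩

theorem corona_adj_swap (H : SimpleGraph V) (x : V ⊕ V) : (corona H).Adj x x.swap := by
  cases x <;> rfl

theorem inner_corona (H : SimpleGraph V) : inner (corona H) = ∅ := by
  rw [Set.eq_empty_iff_forall_notMem]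
  rintro (w | w) ⟨-, hl, hs⟩
  · exact hs (isSupport_corona_inl H w)
  · exact hl (isLeaf_corona_inr H w)

theorem pairwiseDisjoint_leaves_corona (H : SimpleGraph V) :
    (leaves (corona H)).PairwiseDisjoint (corona H).neighborSet := by
  intro l hl m hm hlm
  refine Set.disjoint_left.2 fun s hls hms => hlm ?_
  rw [← Sum.swap_swap l, ← Sum.swap_swap m, hl.eq_of_adj (corona_adj_swap H l) hls,
    hm.eq_of_adj (corona_adj_swap H m) hms]

theorem shadowNumber_corona (H : SimpleGraph V) : shadowNumber (corona H) = 0 :=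
  shadowNumber_eq_zero (inner_corona H) (pairwiseDisjoint_leaves_corona H)

theorem addPendant_adj_none_iff {G : SimpleGraph V} {s : V} {x : Option V} :
    (addPendant G s).Adj none x ↔ x = some s := by
  cases x <;> simp [addPendant]

theorem addPendant_adj_some_some {G : SimpleGraph V} {s v w : V} :
    (addPendant G s).Adj (some v) (some w) ↔ G.Adj v w :=
  Iff.rfl

theorem isLeaf_addPendant_none (G : SimpleGraph V) (s : V) : IsLeaf (addPendant G s) none := by
  simp [IsLeaf, addPendant_adj_none_iff]

theorem isSupport_addPendant_some (G : SimpleGraph V) (s : V) :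
    IsSupport (addPendant G s) (some s) :=
  ⟨none, isLeaf_addPendant_none G s, rfl⟩

theorem isLeaf_addPendant_some_iff {G : SimpleGraph V} {s v : V} (hs : s ∈ G.support) :
    IsLeaf (addPendant G s) (some v) ↔ v ≠ s ∧ IsLeaf G v := by
  constructor
  · intro h
    have hvs : v ≠ s := by
      rintro rfl
      obtain ⟨w, hvw⟩ := hs
      exact Option.some_ne_none w (h.eq_of_adj (addPendant_adj_some_some.2 hvw) rfl)
    obtain ⟨_ | w, hvw, -⟩ := id h
    · exact absurd hvw hvs
    · exact ⟨hvs, w, hvw, fun u hu => Option.some_injective V (h.eq_of_adj hu hvw)⟩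
  · rintro ⟨hvs, w, hvw, hunique⟩
    refine ⟨some w, hvw, ?_⟩
    rintro (_ | u) hu
    · exact absurd hu hvs
    · exact congrArg some (hunique u hu)

theorem inner_addPendant {G : SimpleGraph V} {s : V} (hG : inner G = ∅) (hs : IsSupport G s) :
    inner (addPendant G s) = ∅ := by
  rw [Set.eq_empty_iff_forall_notMem]
  rintro (_ | v) ⟨hv, hl, hsupp⟩
  · exact hl (isLeaf_addPendant_none G s)
  have hvs : v ≠ s := by
    rintro rfl
    exact hsupp (isSupport_addPendant_some G v)
  have hvl : ¬IsLeaf G v := fun h =>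
    hl ((isLeaf_addPendant_some_iff hs.mem_support).2 ⟨hvs, h⟩)
  obtain ⟨_ | w, hvw⟩ := hv
  · exact hvs hvw
  obtain ⟨l, hl', hlv⟩ := (isLeaf_or_isSupport_of_inner_eq_empty hG ⟨w, hvw⟩).resolve_left hvl
  obtain ⟨m, hm, hms⟩ := hs
  by_cases hls : l = s
  · subst hls
    exact hvl (hl'.eq_of_adj hms.symm hlv ▸ hm)
  · exact hsupp ⟨some l, (isLeaf_addPendant_some_iff ⟨m, hms.symm⟩).2 ⟨hls, hl'⟩, hlv⟩

theorem IsShadow.subset_pair_of_addPendant {G : SimpleGraph V} {s l : V} {X : Set (Option V)}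
    (hX : IsShadow (addPendant G s) X) (hG : inner G = ∅)
    (hL : (leaves G).PairwiseDisjoint G.neighborSet) (hl : IsLeaf G l) (hls : G.Adj l s) :
    X ⊆ {none, some l} := by
  have hs : IsSupport G s := ⟨l, hl, hls⟩
  have hleaf {v : V} (hv : some v ∈ X) : IsLeaf G v :=
    ((isLeaf_addPendant_some_iff hs.mem_support).1
      (hX.subset_leaves (inner_addPendant hG hs) hv)).2
  rintro (_ | x) hx
  · exact Or.inl rfl
  obtain ⟨_ | y, hy, hyx, _ | w, -, hxw, hyw⟩ := hX.exists_common_neighbor hx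
  · exact hyw.elim
  · obtain rfl : w = s := hyw
    exact Or.inr (congrArg some (hL.elim_set (hleaf hx) hl w hxw hls))
  · exact absurd (congrArg some (Eq.trans hyw (Eq.symm hxw))) hyx
  · exact absurd (congrArg some (hL.elim_set (hleaf hy) (hleaf hx) w hyw hxw)) hyx

theorem shadowNumber_addPendant {G : SimpleGraph V} {s : V} (hG : inner G = ∅)
    (hL : (leaves G).PairwiseDisjoint G.neighborSet) (hs : IsSupport G s) :
    shadowNumber (addPendant G s) = 2 := by
  obtain ⟨l, hl, hls⟩ := hs
  apply le_antisymm
  · refine shadowNumber_le_iff.2 fun X hX => ?_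
    calc X.encard ≤ Set.encard {none, some l} :=
          Set.encard_le_encard (hX.subset_pair_of_addPendant hG hL hl hls)
      _ = 2 := Set.encard_pair (Option.some_ne_none l).symm
  · refine two_le_shadowNumber_of_twins (x := none) (y := some l) (w := some s)
      (Option.some_ne_none l).symm ?_ (addPendant_adj_none_iff.2 rfl) (by simpa using hls.ne')
    rintro (_ | v) hv -
    · exact absurd rfl hv
    · rw [addPendant_adj_none_iff, Option.some_inj, addPendant_adj_some_some]
      exact ⟨fun h => h ▸ hls, fun h => hl.eq_of_adj h hls⟩

theorem IsC3OrC4OrDiadem.shadowNumber_eq_two {G : SimpleGraph V} (hG : IsC3OrC4OrDiadem G) :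
    shadowNumber G = 2 := by
  obtain ⟨⟨e⟩⟩ | ⟨⟨e⟩⟩ | ⟨W, H, s, hs, ⟨e⟩⟩ := hG
  · exact (shadowNumber_congr e).trans shadowNumber_cycleGraph_three
  · exact (shadowNumber_congr e).trans shadowNumber_cycleGraph_four
  · exact (shadowNumber_congr e).trans
      (shadowNumber_addPendant (inner_corona H) (pairwiseDisjoint_leaves_corona H) hs)

/-! ### Largest enclaveless sets -/

theorem isEnclaveless_empty (G : SimpleGraph A) : IsEnclaveless G ∅ := by
  simp [IsEnclaveless]

theorem IsEnclaveless.exchange {G : SimpleGraph A} {Y : Set A} {v y : A} (hY : IsEnclaveless G Y)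
    (hv : v ∉ Y) (hvy : G.Adj v y) (honly : ∀ z ∈ Y, G.Adj v z → z = y) :
    IsEnclaveless G (insert v (Y \ {y})) := by
  rintro x (rfl | ⟨hx, hxy⟩)
  · exact ⟨y, by simp [hvy.ne'], hvy⟩
  · obtain ⟨w, hw, hxw⟩ := hY x hx
    have hwv : w ≠ v := by
      rintro rfl
      exact hxy (honly x hx hxw.symm)
    exact ⟨w, by simp [hwv, hw], hxw⟩

theorem IsEnclaveless.exists_neighborSet_subset_insert {G : SimpleGraph A} {Y : Set A} {v : A}
    (hY : IsEnclaveless G Y) (hins : ¬IsEnclaveless G (insert v Y))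
    (hvY : ¬G.neighborSet v ⊆ Y) :
    ∃ y ∈ Y, G.Adj v y ∧ G.neighborSet y ⊆ insert v Y := by
  simp only [IsEnclaveless, not_forall, not_exists, not_and] at hins
  obtain ⟨y, hy, hnbr⟩ := hins
  have hsub : G.neighborSet y ⊆ insert v Y := fun w hw => by_contra fun h => hnbr w h hw
  rcases hy with rfl | hy
  · exact absurd (fun w hw => (hsub hw).resolve_left (SimpleGraph.Adj.ne' hw)) hvY
  · obtain ⟨w, hw, hyw⟩ := hY y hy
    obtain rfl : w = v := (hsub hyw).resolve_right hw
    exact ⟨y, hy, hyw.symm, hsub⟩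

/-- The edges, as ordered pairs, of the subgraph induced by the complement of `Y`: the quantity
minimised among the largest enclaveless sets. -/
def outerDarts (G : SimpleGraph A) (Y : Set A) : Set (A × A) :=
  {p | p.1 ∉ Y ∧ p.2 ∉ Y ∧ G.Adj p.1 p.2}

theorem outerDarts_exchange_ssubset {G : SimpleGraph A} {Y : Set A} {v y : A} (hv : v ∉ Y)
    (hsub : G.neighborSet y ⊆ insert v Y) (hvY : ¬G.neighborSet v ⊆ Y) :
    outerDarts G (insert v (Y \ {y})) ⊂ outerDarts G Y := by
  have not_mem {a b : A} (ha : a ∉ insert v (Y \ {y})) (hb : b ∉ insert v (Y \ {y}))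
      (hab : G.Adj a b) : a ∉ Y := by
    intro haY
    obtain rfl : a = y := by_contra fun h => ha (Or.inr ⟨haY, h⟩)
    rcases hsub hab with rfl | hbY
    · exact hb (Or.inl rfl)
    · exact hb (Or.inr ⟨hbY, hab.ne'⟩)
  obtain ⟨w, hvw, hw⟩ := Set.not_subset.1 hvY
  refine Set.ssubset_iff_of_subset ?_ |>.2 ⟨(v, w), ⟨hv, hw, hvw⟩, fun h => h.1 (Or.inl rfl)⟩
  rintro ⟨a, b⟩ ⟨ha, hb, hab⟩
  exact ⟨not_mem ha hb hab, not_mem hb ha hab.symm, hab⟩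

theorem exists_maximum_enclaveless [Finite A] {G : SimpleGraph A} {R : Set A}
    (hR : ∀ r ∈ R, (G.neighborSet r).Nontrivial) :
    ∃ Y ⊆ R, IsEnclaveless G Y ∧ (∀ Z ⊆ R, IsEnclaveless G Z → Z.ncard ≤ Y.ncard) ∧
      ∀ v ∈ R \ Y, (G.neighborSet v ∩ Y).Nontrivial := by
  obtain ⟨Y, ⟨hYR, hY⟩, hmax⟩ := Set.exists_max_image {Y | Y ⊆ R ∧ IsEnclaveless G Y}
    (fun Y => toLex (Y.ncard, OrderDual.toDual (outerDarts G Y).ncard)) (Set.toFinite _)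
    ⟨∅, Set.empty_subset R, isEnclaveless_empty G⟩
  simp only [Prod.Lex.toLex_le_toLex, OrderDual.toDual_le_toDual] at hmax
  have hncard (Z : Set A) (hZR : Z ⊆ R) (hZ : IsEnclaveless G Z) : Z.ncard ≤ Y.ncard :=
    (hmax Z ⟨hZR, hZ⟩).elim le_of_lt fun h => h.1.le
  refine ⟨Y, hYR, hY, hncard, fun v ⟨hvR, hvY⟩ => ?_⟩
  by_contra hsubsingleton
  rw [Set.not_nontrivial_iff] at hsubsingleton
  have hvnot : ¬G.neighborSet v ⊆ Y := fun h =>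
    (hR v hvR).not_subsingleton (Set.inter_eq_left.2 h ▸ hsubsingleton)
  have hins : ¬IsEnclaveless G (insert v Y) := fun h => by
    have := hncard _ (Set.insert_subset hvR hYR) h
    rw [Set.ncard_insert_of_notMem hvY] at this
    omega
  obtain ⟨y, hy, hvy, hsub⟩ := hY.exists_neighborSet_subset_insert hins hvnot
  have hexchange : IsEnclaveless G (insert v (Y \ {y})) :=
    hY.exchange hvY hvy fun z hz hvz => hsubsingleton ⟨hvz, hz⟩ ⟨hvy, hy⟩
  have hcard : (insert v (Y \ {y})).ncard = Y.ncard := Set.ncard_exchange hvY hy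
  have hlt := Set.ncard_lt_ncard (outerDarts_exchange_ssubset hvY hsub hvnot)
  have := hmax _ ⟨Set.insert_subset hvR (Set.sdiff_subset.trans hYR), hexchange⟩
  omega

theorem isEnclaveless_of_subset_neighborSet {G : SimpleGraph A} {Z : Set A} {a : A}
    (hZ : Z ⊆ G.neighborSet a) : IsEnclaveless G Z :=
  fun _ hz => ⟨a, fun ha => G.irrefl (hZ ha), (hZ hz).symm⟩

/-! ### Inner vertices -/

/-- A set of inner vertices satisfying the conditions of a shadow, except that the support vertices
may have exactly one neighbour in it. -/
structure IsInnerShadow (G : SimpleGraph V) (Y : Set V) : Prop where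
  subset_inner : Y ⊆ inner G
  isEnclaveless : IsEnclaveless G Y
  exists_adj_ne : ∀ v ∈ inner G \ Y, ∀ x ∈ Y, G.Adj v x → ∃ y ∈ Y, y ≠ x ∧ G.Adj v y

/-- The set `Y` together with all leaves at those support vertices that have another neighbour
which is in `Y` or a leaf. -/
def leafExtension (G : SimpleGraph V) (Y : Set V) : Set V :=
  Y ∪ {l ∈ leaves G | ∃ s, G.Adj l s ∧ ∃ y ∈ Y ∪ leaves G, y ≠ l ∧ G.Adj s y}

theorem subset_leafExtension (G : SimpleGraph V) (Y : Set V) : Y ⊆ leafExtension G Y :=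
  Set.subset_union_left

theorem IsLeaf.mem_leafExtension {G : SimpleGraph V} {Y : Set V} {l s y : V} (hl : IsLeaf G l)
    (hls : G.Adj l s) (hy : y ∈ Y ∪ leaves G) (hyl : y ≠ l) (hys : G.Adj y s) :
    l ∈ leafExtension G Y :=
  Or.inr ⟨hl, s, hls, y, hy, hyl, hys.symm⟩

theorem IsLeaf.ne_of_mem_inner {G : SimpleGraph V} {l r : V} (hl : IsLeaf G l)
    (hr : r ∈ inner G) : l ≠ r := by
  rintro rfl
  exact hr.2.1 hl

theorem isInnerShadow_empty (G : SimpleGraph V) : IsInnerShadow G ∅ :=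
  ⟨Set.empty_subset _, isEnclaveless_empty G, by simp⟩

theorem IsInnerShadow.isEnclaveless_leafExtension {G : SimpleGraph V} {Y : Set V}
    (hY : IsInnerShadow G Y) : IsEnclaveless G (leafExtension G Y) := by
  rintro x (hx | ⟨hx, s, hxs, y, -, hyx, hsy⟩)
  · obtain ⟨w, hw, hxw⟩ := hY.isEnclaveless x hx
    refine ⟨w, ?_, hxw⟩
    rintro (hwY | ⟨hwl, -⟩)
    · exact hw hwY
    · exact (hY.subset_inner hx).2.2 ⟨w, hwl, hxw.symm⟩
  · refine ⟨s, ?_, hxs⟩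
    rintro (hsY | ⟨hsl, -⟩)
    · exact (hY.subset_inner hsY).2.2 ⟨x, hx, hxs⟩
    · exact hyx (IsLeaf.eq_of_adj hsl hsy hxs.symm)

theorem IsInnerShadow.isShadow_leafExtension {G : SimpleGraph V} {Y : Set V}
    (hY : IsInnerShadow G Y) : IsShadow G (leafExtension G Y) := by
  refine ⟨hY.isEnclaveless_leafExtension, ?_⟩
  rintro v hv x (hx | ⟨hx, s, hxs, y, hy, hyx, hsy⟩) hvx
  · have hxinner := hY.subset_inner hx
    by_cases hvs : IsSupport G v
    · obtain ⟨l, hl, hlv⟩ := hvs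
      have hxl : x ≠ l := (hl.ne_of_mem_inner hxinner).symm
      exact ⟨l, hl.mem_leafExtension hlv (Or.inl hx) hxl hvx.symm, hxl.symm, hlv.symm⟩
    · have hvinner := (mem_inner_or_isSupport_of_adj hxinner hvx.symm).resolve_right hvs
      obtain ⟨y, hy, hyx, hvy⟩ :=
        hY.exists_adj_ne v ⟨hvinner, fun h => hv (subset_leafExtension G Y h)⟩ x hx hvx
      exact ⟨y, subset_leafExtension G Y hy, hyx, hvy⟩
  · obtain rfl := IsLeaf.eq_of_adj hx hxs hvx.symm
    refine ⟨y, ?_, hyx, hsy⟩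
    rcases hy with hy | hy
    · exact subset_leafExtension G Y hy
    · exact IsLeaf.mem_leafExtension hy hsy.symm (Or.inr hx) hyx.symm hxs

theorem IsInnerShadow.eq_pair {G : SimpleGraph V} {Y : Set V} {a b : V} (hY : IsInnerShadow G Y)
    (hG : shadowNumber G ≤ 2) (ha : a ∈ Y) (hb : b ∈ Y) (hab : a ≠ b) : Y = {a, b} := by
  have hsub := subset_leafExtension G Y
  rw [hY.isShadow_leafExtension.eq_pair hG (hsub ha) (hsub hb) hab] at hsub
  exact hsub.antisymm (Set.pair_subset ha hb)

theorem IsInnerShadow.not_adj_of_isSupport {G : SimpleGraph V} {Y : Set V} {y z s : V}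
    (hY : IsInnerShadow G Y) (hG : shadowNumber G ≤ 2) (hy : y ∈ Y) (hz : z ∈ Y) (hyz : y ≠ z)
    (hs : IsSupport G s) : ¬G.Adj y s := by
  obtain ⟨l, hl, hls⟩ := hs
  intro hys
  have hly := hl.ne_of_mem_inner (hY.subset_inner hy)
  have hpair := hY.isShadow_leafExtension.eq_pair hG (subset_leafExtension G Y hy)
    (subset_leafExtension G Y hz) hyz
  rcases hpair.subset (hl.mem_leafExtension hls (Or.inl hy) hly.symm hys) with h | h
  · exact hly h
  · exact hl.ne_of_mem_inner (hY.subset_inner hz) h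

theorem IsInnerShadow.pairwiseDisjoint_leaves {G : SimpleGraph V} {Y : Set V}
    (hY : IsInnerShadow G Y) (hne : Y.Nonempty) (hG : shadowNumber G ≤ 2) :
    (leaves G).PairwiseDisjoint G.neighborSet := by
  obtain ⟨y, hy⟩ := hne
  intro l hl m hm hlm
  refine Set.disjoint_left.2 fun s hls hms => ?_
  have hpair := hY.isShadow_leafExtension.eq_pair hG
    (IsLeaf.mem_leafExtension hl hls (Or.inr hm) hlm.symm hms)
    (IsLeaf.mem_leafExtension hm hms (Or.inr hl) hlm hls) hlm
  rcases hpair.subset (subset_leafExtension G Y hy) with h | h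
  · exact IsLeaf.ne_of_mem_inner hl (hY.subset_inner hy) h.symm
  · exact IsLeaf.ne_of_mem_inner hm (hY.subset_inner hy) h.symm

theorem IsInnerShadow.exists_ne_mem {G : SimpleGraph V} {Y : Set V} {y : V}
    (hY : IsInnerShadow G Y) (hG : shadowNumber G ≤ 2) (hinner : inner G ⊆ Y) (hy : y ∈ Y) :
    ∃ z ∈ Y, z ≠ y := by
  by_contra! hunique
  have hyinner := hY.subset_inner hy
  have hsupport : ∀ s ∈ G.neighborSet y, IsSupport G s := fun s hys =>
    (mem_inner_or_isSupport_of_adj hyinner hys).resolve_left fun h =>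
      SimpleGraph.Adj.ne' hys (hunique s (hinner h))
  obtain ⟨s, hys, t, hyt, hst⟩ := nontrivial_neighborSet hyinner.1 hyinner.2.1
  obtain ⟨l, hl, hls⟩ := hsupport s hys
  obtain ⟨m, hm, hmt⟩ := hsupport t hyt
  have hly := hl.ne_of_mem_inner hyinner
  have hmy := hm.ne_of_mem_inner hyinner
  have hpair := hY.isShadow_leafExtension.eq_pair hG (subset_leafExtension G Y hy)
    (hl.mem_leafExtension hls (Or.inl hy) hly.symm hys) hly.symm
  rcases hpair.subset (hm.mem_leafExtension hmt (Or.inl hy) hmy.symm hyt) with rfl | rfl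
  · exact hmy rfl
  · exact hst (hl.eq_of_adj hls hmt)

/-- Two inner vertices that are both adjacent to each of the other inner vertices, of which there is
at least one. -/
structure IsJoinedPair (G : SimpleGraph V) (a b : V) : Prop where
  left_mem : a ∈ inner G
  right_mem : b ∈ inner G
  ne : a ≠ b
  nonempty : (inner G \ {a, b}).Nonempty
  adj_left : ∀ v ∈ inner G \ {a, b}, G.Adj v a
  adj_right : ∀ v ∈ inner G \ {a, b}, G.Adj v b

theorem IsJoinedPair.symm {G : SimpleGraph V} {a b : V} (h : IsJoinedPair G a b) :
    IsJoinedPair G b a := by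
  obtain ⟨ha, hb, hab, hne, hl, hr⟩ := h
  rw [Set.pair_comm] at hne hl hr
  exact ⟨hb, ha, hab.symm, hne, hr, hl⟩

theorem IsJoinedPair.isInnerShadow {G : SimpleGraph V} {a b : V} (h : IsJoinedPair G a b) :
    IsInnerShadow G {a, b} := by
  refine ⟨Set.pair_subset h.left_mem h.right_mem, ?_, fun v hv => ?_⟩
  · obtain ⟨w, hw⟩ := h.nonempty
    rintro x (rfl | rfl)
    · exact ⟨w, hw.2, (h.adj_left w hw).symm⟩
    · exact ⟨w, hw.2, (h.adj_right w hw).symm⟩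
  · rintro x (rfl | rfl) -
    · exact ⟨b, by simp, h.ne.symm, h.adj_right v hv⟩
    · exact ⟨a, by simp, h.ne, h.adj_left v hv⟩

theorem IsJoinedPair.not_adj_of_isSupport {G : SimpleGraph V} {a b s : V} (h : IsJoinedPair G a b)
    (hG : shadowNumber G ≤ 2) (hs : IsSupport G s) : ¬G.Adj a s :=
  h.isInnerShadow.not_adj_of_isSupport hG (by simp) (by simp) h.ne hs

theorem exists_isInnerShadow_maximum [Finite V] (G : SimpleGraph V) :
    ∃ Y, IsInnerShadow G Y ∧ (∀ Z ⊆ inner G, IsEnclaveless G Z → Z.ncard ≤ Y.ncard) ∧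
      ∀ v ∈ inner G \ Y, (G.neighborSet v ∩ Y).Nontrivial := by
  obtain ⟨Y, hYinner, hY, hmax, hnbr⟩ := exists_maximum_enclaveless (R := inner G)
    fun r hr => nontrivial_neighborSet hr.1 hr.2.1
  refine ⟨Y, ⟨hYinner, hY, fun v hv x _ _ => ?_⟩, hmax, hnbr⟩
  obtain ⟨y, ⟨hvy, hy⟩, hyx⟩ := (hnbr v hv).exists_ne x
  exact ⟨y, hy, hyx, hvy⟩

theorem exists_isJoinedPair [Finite V] {G : SimpleGraph V} (hG : shadowNumber G ≤ 2)
    (hne : (inner G).Nonempty) :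
    ∃ a b, IsJoinedPair G a b ∧ ∀ Z ⊆ inner G, IsEnclaveless G Z → Z.ncard ≤ 2 := by
  obtain ⟨Y, hY, hmax, hnbr⟩ := exists_isInnerShadow_maximum G
  obtain ⟨a, ha, b, hb, hab⟩ : Y.Nontrivial := by
    by_contra hsub
    rw [Set.not_nontrivial_iff] at hsub
    have hinner : inner G ⊆ Y := fun v hv => by_contra fun hvY =>
      (hnbr v ⟨hv, hvY⟩).not_subsingleton (hsub.anti Set.inter_subset_right)
    obtain ⟨y, hy⟩ := hne
    obtain ⟨z, hz, hzy⟩ := hY.exists_ne_mem hG hinner (hinner hy)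
    exact hzy (hsub hz (hinner hy))
  obtain rfl := hY.eq_pair hG ha hb hab
  rw [Set.ncard_pair hab] at hmax
  obtain ⟨w, hw, haw⟩ := hY.isEnclaveless a ha
  have hwinner : w ∈ inner G :=
    (mem_inner_or_isSupport_of_adj (hY.subset_inner ha) haw).resolve_right fun hs =>
      hY.not_adj_of_isSupport hG ha hb hab hs haw
  refine ⟨a, b, ⟨hY.subset_inner ha, hY.subset_inner hb, hab, ⟨w, hwinner, hw⟩, fun v hv => ?_,
    fun v hv => ?_⟩, hmax⟩
  · obtain ⟨y, ⟨hvy, rfl | rfl⟩, hyb⟩ := (hnbr v hv).exists_ne b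
    · exact hvy
    · exact absurd rfl hyb
  · obtain ⟨y, ⟨hvy, rfl | rfl⟩, hya⟩ := (hnbr v hv).exists_ne a
    · exact absurd rfl hya
    · exact hvy

theorem IsJoinedPair.inner_eq {G : SimpleGraph V} {a b : V} {D : Set V} (h : IsJoinedPair G a b)
    (hD : inner G \ {a, b} = D) : inner G = {a, b} ∪ D := by
  rw [← hD, Set.union_sdiff_cancel (Set.pair_subset h.left_mem h.right_mem)]

theorem IsJoinedPair.adj_of_diff_eq_singleton {G : SimpleGraph V} {a b d : V}
    (h : IsJoinedPair G a b) (hG : shadowNumber G ≤ 2) (hD : inner G \ {a, b} = {d}) :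
    G.Adj a b := by
  obtain ⟨w, haw, hwd⟩ :=
    (nontrivial_neighborSet h.left_mem.1 h.left_mem.2.1).exists_ne d
  have hw : w ∈ inner G := (mem_inner_or_isSupport_of_adj h.left_mem haw).resolve_right
    fun hs => h.not_adj_of_isSupport hG hs haw
  rw [h.inner_eq hD] at hw
  obtain (rfl | rfl) | rfl := hw
  · exact absurd haw G.irrefl
  · exact haw
  · exact absurd rfl hwd

theorem IsJoinedPair.of_diff_eq_singleton {G : SimpleGraph V} {a b d : V}
    (h : IsJoinedPair G a b) (hD : inner G \ {a, b} = {d}) (hab : G.Adj a b) :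
    IsJoinedPair G d a := by
  have hd : d ∈ inner G \ {a, b} := hD ▸ Set.mem_singleton d
  have hadj := h.adj_right d hd
  have hdiff : inner G \ {d, a} = {b} := by
    rw [h.inner_eq hD]
    ext v
    grind [G.ne_of_adj hab, G.ne_of_adj hadj]
  refine ⟨hd.1, h.left_mem, (h.adj_left d hd).ne, hdiff ▸ Set.singleton_nonempty b, ?_, ?_⟩
  · simpa [hdiff] using hadj.symm
  · simpa [hdiff] using hab.symm

theorem IsJoinedPair.diff_eq_of_diff_eq_pair {G : SimpleGraph V} {a b d e : V}
    (h : IsJoinedPair G a b) (hD : inner G \ {a, b} = {d, e}) : inner G \ {d, e} = {a, b} := by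
  rw [← hD, Set.sdiff_sdiff_cancel_left (Set.pair_subset h.left_mem h.right_mem)]

theorem IsJoinedPair.of_diff_eq_pair {G : SimpleGraph V} {a b d e : V}
    (h : IsJoinedPair G a b) (hD : inner G \ {a, b} = {d, e}) (hde : d ≠ e) :
    IsJoinedPair G d e := by
  have hd : d ∈ inner G \ {a, b} := hD ▸ Set.mem_insert d {e}
  have he : e ∈ inner G \ {a, b} := hD ▸ Set.mem_insert_of_mem d rfl
  have hdiff := h.diff_eq_of_diff_eq_pair hD
  refine ⟨hd.1, he.1, hde, hdiff ▸ Set.insert_nonempty a {b}, ?_, ?_⟩ <;> rw [hdiff]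
  · rintro v (rfl | rfl)
    exacts [(h.adj_left d hd).symm, (h.adj_right d hd).symm]
  · rintro v (rfl | rfl)
    exacts [(h.adj_left e he).symm, (h.adj_right e he).symm]

theorem IsJoinedPair.not_adj_of_diff_eq_pair {G : SimpleGraph V} {a b d e : V}
    (h : IsJoinedPair G a b) (hmax : ∀ Z ⊆ inner G, IsEnclaveless G Z → Z.ncard ≤ 2)
    (hD : inner G \ {a, b} = {d, e}) (hde : d ≠ e) : ¬G.Adj a b := by
  have hd : d ∈ inner G \ {a, b} := hD ▸ Set.mem_insert d {e}
  have he : e ∈ inner G \ {a, b} := hD ▸ Set.mem_insert_of_mem d rfl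
  intro hab
  have hb : b ∉ ({d, e} : Set V) := hD ▸ fun hb => hb.2 (Or.inr rfl)
  have hsub : {b, d, e} ⊆ inner G :=
    Set.insert_subset h.right_mem (Set.pair_subset hd.1 he.1)
  have hnbr : {b, d, e} ⊆ G.neighborSet a :=
    Set.insert_subset hab (Set.pair_subset (h.adj_left d hd).symm (h.adj_left e he).symm)
  have hle := hmax _ hsub (isEnclaveless_of_subset_neighborSet hnbr)
  rw [Set.ncard_insert_of_notMem hb, Set.ncard_pair hde] at hle
  omega

theorem IsJoinedPair.diff_eq_singleton_or_pair [Finite V] {G : SimpleGraph V} {a b : V}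
    (h : IsJoinedPair G a b) (hmax : ∀ Z ⊆ inner G, IsEnclaveless G Z → Z.ncard ≤ 2) :
    (∃ d, inner G \ {a, b} = {d}) ∨ ∃ d e, d ≠ e ∧ inner G \ {a, b} = {d, e} := by
  rw [← Set.ncard_eq_one, ← Set.ncard_eq_two]
  have hle := hmax _ Set.sdiff_subset
    (isEnclaveless_of_subset_neighborSet fun v hv => (h.adj_left v hv).symm)
  have hpos := (Set.ncard_pos).2 h.nonempty
  omega

/-! ### Embeddings -/

theorem exists_embedding_cycleGraph_three {G : SimpleGraph A} {a b c : A} (hab : G.Adj a b)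
    (hbc : G.Adj b c) (hca : G.Adj c a) : ∃ f : cycleGraph 3 ↪g G, Set.range f = {a, b, c} := by
  have hinj : Function.Injective ![a, b, c] := by
    intro i j
    fin_cases i <;> fin_cases j <;>
      simp [hab.ne, hbc.ne, hca.ne, hab.ne', hbc.ne', hca.ne']
  refine ⟨⟨⟨_, hinj⟩, fun {i j} => ?_⟩,
    by simp only [RelEmbedding.coe_mk, Function.Embedding.coeFn_mk, Matrix.range_cons,
      Matrix.range_empty, Set.union_empty, Set.insert_eq]⟩
  rw [cycleGraph_three_eq_top, top_adj]
  fin_cases i <;> fin_cases j <;> simp [hab, hbc, hca, hab.symm, hbc.symm, hca.symm]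

theorem exists_embedding_cycleGraph_four {G : SimpleGraph A} {a b c d : A} (hab : G.Adj a b)
    (hbc : G.Adj b c) (hcd : G.Adj c d) (hda : G.Adj d a) (hac : a ≠ c) (hbd : b ≠ d)
    (hac' : ¬G.Adj a c) (hbd' : ¬G.Adj b d) :
    ∃ f : cycleGraph 4 ↪g G, Set.range f = {a, b, c, d} := by
  have hinj : Function.Injective ![a, b, c, d] := by
    intro i j
    fin_cases i <;> fin_cases j <;>
      simp [hab.ne, hbc.ne, hcd.ne, hda.ne, hab.ne', hbc.ne', hcd.ne', hda.ne', hac, hbd,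
        hac.symm, hbd.symm]
  refine ⟨⟨⟨_, hinj⟩, fun {i j} => ?_⟩,
    by simp only [RelEmbedding.coe_mk, Function.Embedding.coeFn_mk, Matrix.range_cons,
      Matrix.range_empty, Set.union_empty, Set.insert_eq]⟩
  have hca' : ¬G.Adj c a := fun h => hac' h.symm
  have hdb' : ¬G.Adj d b := fun h => hbd' h.symm
  have hadj : ∀ i j : Fin 4, (cycleGraph 4).Adj i j ↔ i = j + 1 ∨ j = i + 1 := by decide
  rw [hadj]
  fin_cases i <;> fin_cases j <;>
    simp [hab, hbc, hcd, hda, hab.symm, hbc.symm, hcd.symm, hda.symm, hac', hbd', hca', hdb']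

theorem exists_embedding_sum {G : SimpleGraph V} {G₁ : SimpleGraph A} {G₂ : SimpleGraph B}
    (f : G₁ ↪g G) (g : G₂ ↪g G) (hdisj : Disjoint (Set.range f) (Set.range g))
    (hadj : ∀ a b, ¬G.Adj (f a) (g b)) :
    ∃ e : (G₁ ⊕g G₂) ↪g G, Set.range e = Set.range f ∪ Set.range g := by
  have hinj : Function.Injective (Sum.elim f g) := f.injective.sumElim g.injective fun a b =>
    Set.disjoint_range_iff.1 hdisj a b
  refine ⟨⟨⟨_, hinj⟩, ?_⟩, Set.Sum.elim_range f g⟩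
  rintro (a | a) (b | b)
  · simp
  · simpa using hadj a b
  · simpa [G.adj_comm] using hadj b a
  · simp

theorem exists_embedding_corona {G : SimpleGraph V} {W : Type*} {l t : W → V}
    (hl : ∀ w v, G.Adj (l w) v ↔ v = t w) (ht : Function.Injective t)
    (hlt : ∀ w w', l w ≠ t w') :
    ∃ f : corona (G.comap t) ↪g G, Set.range f = Set.range t ∪ Set.range l := by
  have hl_injective : Function.Injective l := fun a b hab =>
    ht ((hl b _).1 (hab ▸ (hl a _).2 rfl))
  have hinj : Function.Injective (Sum.elim t l) := ht.sumElim hl_injective fun a b => (hlt b a).symm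
  refine ⟨⟨⟨_, hinj⟩, ?_⟩, Set.Sum.elim_range t l⟩
  rintro (a | a) (b | b)
  · exact Iff.rfl
  · change G.Adj (t a) (l b) ↔ a = b
    rw [G.adj_comm, hl, ht.eq_iff]
  · change G.Adj (l a) (t b) ↔ a = b
    rw [hl, ht.eq_iff, eq_comm]
  · change G.Adj (l a) (l b) ↔ False
    rw [hl, iff_false]
    exact hlt b a

theorem exists_leaf_transversal {G : SimpleGraph V} {L : Set V} (hL : L ⊆ leaves G)
    (hdisj : L.PairwiseDisjoint G.neighborSet) :
    ∃ (W : Type u) (l t : W → V), (∀ w v, G.Adj (l w) v ↔ v = t w) ∧ Function.Injective t ∧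
      (∀ w w', l w ≠ t w') ∧ Set.range t ∪ Set.range l = L ∪ {s | ∃ l ∈ L, G.Adj l s} := by
  choose t ht using fun l : L => (hL l.2).exists
  have adj_iff (l : L) (v : V) : G.Adj l v ↔ v = t l :=
    ⟨fun h => IsLeaf.eq_of_adj (hL l.2) h (ht l), fun h => h ▸ ht l⟩
  have ht_injective : Function.Injective t := fun l m h =>
    Subtype.ext (hdisj.elim_set l.2 m.2 (t l) (ht l) (h ▸ ht m))
  -- Indexing by the edges `s(l, t l)` selects one end of each component `K₂`.
  let e (l : L) : Sym2 V := s(↑l, t l)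
  let r : Set.range e → L := Set.rangeSplitting e
  have he (w : Set.range e) : e (r w) = w := Set.apply_rangeSplitting e w
  refine ⟨Set.range e, fun w => r w, fun w => t (r w), fun w => adj_iff (r w),
    ht_injective.comp (Set.rangeSplitting_injective e), fun w w' h => ?_, ?_⟩
  · have hback : (r w' : V) = t (r w) := (adj_iff _ _).1 ((adj_iff _ _).2 h).symm
    have hedge : e (r w) = e (r w') := by
      simp only [e, ← h, ← hback, Sym2.eq_swap]
    obtain rfl : w = w' := Subtype.ext ((he w).symm.trans (hedge.trans (he w')))
    exact G.irrefl ((adj_iff _ _).2 h)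
  · have hcover (l : L) : ∃ w, r w = l ∨ (r w : V) = t l ∧ t (r w) = l := by
      have := he ⟨e l, l, rfl⟩
      simp only [e, Sym2.eq_iff] at this
      exact ⟨_, this.imp_left fun h => Subtype.ext h.1⟩
    apply Set.Subset.antisymm
    · rintro _ (⟨w, rfl⟩ | ⟨w, rfl⟩)
      · exact Or.inr ⟨r w, (r w).2, ht (r w)⟩
      · exact Or.inl (r w).2
    · rintro v (hv | ⟨l, hl, hlv⟩)
      · obtain ⟨w, hw | ⟨-, hw⟩⟩ := hcover ⟨v, hv⟩
        · exact Or.inr ⟨w, congrArg Subtype.val hw⟩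
        · exact Or.inl ⟨w, hw⟩
      · obtain rfl := (adj_iff ⟨l, hl⟩ v).1 hlv
        obtain ⟨w, hw | ⟨hw, -⟩⟩ := hcover ⟨l, hl⟩
        · exact Or.inl ⟨w, congrArg t hw⟩
        · exact Or.inr ⟨w, hw⟩

theorem exists_embedding_corona_of_leaves {G : SimpleGraph V} {L : Set V} (hL : L ⊆ leaves G)
    (hdisj : L.PairwiseDisjoint G.neighborSet) :
    ∃ (W : Type u) (H : SimpleGraph W) (f : corona H ↪g G),
      Set.range f = L ∪ {s | ∃ l ∈ L, G.Adj l s} := by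
  obtain ⟨W, l, t, hl, ht, hlt, hrange⟩ := exists_leaf_transversal hL hdisj
  obtain ⟨f, hf⟩ := exists_embedding_corona hl ht hlt
  exact ⟨W, G.comap t, f, hf.trans hrange⟩

theorem exists_embedding_addPendant {G : SimpleGraph V} {W : Type*} {G' : SimpleGraph W}
    (f : G' ↪g G) {s : W} {l : V} (hl : ∀ v, G.Adj l v ↔ v = f s) (hlf : l ∉ Set.range f) :
    ∃ e : addPendant G' s ↪g G, Set.range e = insert l (Set.range f) := by
  have hinj : Function.Injective fun o : Option W => o.elim l f :=
    Option.injective_iff.2 ⟨f.injective, hlf⟩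
  refine ⟨⟨⟨_, hinj⟩, ?_⟩, Option.range_elim l f⟩
  rintro (_ | a) (_ | b)
  · change G.Adj l l ↔ False
    simp
  · change G.Adj l (f b) ↔ b = s
    rw [hl, f.injective.eq_iff]
  · change G.Adj (f a) l ↔ a = s
    rw [G.adj_comm, hl, f.injective.eq_iff]
  · exact f.map_adj_iff

theorem exists_iso_sum_bot [Finite V] {G : SimpleGraph V} {G' : SimpleGraph A} (f : G' ↪g G)
    (hf : Set.range f = G.support) :
    ∃ k, Nonempty (G ≃g G' ⊕g (⊥ : SimpleGraph (Fin k))) := by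
  obtain ⟨k, ⟨i⟩⟩ := Finite.exists_equiv_fin ↥G.supportᶜ
  have isolated (j : Fin k) (v : V) : ¬G.Adj v (i.symm j) := fun h => (i.symm j).2 ⟨v, h.symm⟩
  let g : (⊥ : SimpleGraph (Fin k)) ↪g G :=
    ⟨⟨fun j => i.symm j, Subtype.val_injective.comp i.symm.injective⟩, fun {a b} => by
      simpa using isolated b (i.symm a)⟩
  have hg : Set.range g = G.supportᶜ :=
    (i.symm.surjective.range_comp Subtype.val).trans Subtype.range_val
  obtain ⟨e, he⟩ := exists_embedding_sum f g (hf ▸ hg ▸ disjoint_compl_right)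
    fun a b => isolated b (f a)
  have hsurj : Function.Surjective e := by
    rw [← Set.range_eq_univ, he, hf, hg, Set.union_compl_self]
  exact ⟨k, ⟨(RelIso.ofSurjective e hsurj).symm⟩⟩

theorem IsLeaf.of_embedding {G : SimpleGraph V} {W : Type*} {G' : SimpleGraph W} (f : G' ↪g G)
    {l s : W} (h : IsLeaf G (f l)) (hls : G'.Adj l s) : IsLeaf G' l :=
  ⟨s, hls, fun _ ht => f.injective (h.eq_of_adj (f.map_adj_iff.2 ht) (f.map_adj_iff.2 hls))⟩

/-! ### Graphs with shadow number two -/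

theorem exists_twin_leaves {G : SimpleGraph V} (hinner : inner G = ∅) (hG : shadowNumber G ≠ 0) :
    ∃ x y s, IsLeaf G x ∧ IsLeaf G y ∧ x ≠ y ∧ G.Adj x s ∧ G.Adj y s := by
  by_contra! h
  refine hG (shadowNumber_eq_zero hinner fun x hx y hy hxy => ?_)
  exact Set.disjoint_left.2 fun s => h x y s hx hy hxy

theorem pairwiseDisjoint_leaves_diff_singleton {G : SimpleGraph V} {x y s : V}
    (hG : shadowNumber G ≤ 2) (hx : IsLeaf G x) (hy : IsLeaf G y) (hxy : x ≠ y)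
    (hxs : G.Adj x s) (hys : G.Adj y s) : (leaves G \ {y}).PairwiseDisjoint G.neighborSet := by
  have hpair := (isInnerShadow_empty G).isShadow_leafExtension.eq_pair hG
    (hx.mem_leafExtension hxs (Or.inr hy) hxy.symm hys)
    (hy.mem_leafExtension hys (Or.inr hx) hxy hxs) hxy
  rintro l ⟨hl, hly⟩ m ⟨hm, hmy⟩ hlm
  refine Set.disjoint_left.2 fun t hlt hmt => hlm ?_
  have hlx := (hpair.subset (IsLeaf.mem_leafExtension hl hlt (Or.inr hm) hlm.symm hmt))
  have hmx := (hpair.subset (IsLeaf.mem_leafExtension hm hmt (Or.inr hl) hlm hlt))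
  exact (hlx.resolve_right hly).trans (hmx.resolve_right hmy).symm

theorem exists_iso_of_inner_eq_empty [Finite V] {G : SimpleGraph V} (hG : shadowNumber G = 2)
    (hinner : inner G = ∅) :
    ∃ (B : Type u) (G₀ : SimpleGraph B) (k : ℕ), IsC3OrC4OrDiadem G₀ ∧
      Nonempty (G ≃g G₀ ⊕g (⊥ : SimpleGraph (Fin k))) := by
  obtain ⟨x, y, s, hx, hy, hxy, hxs, hys⟩ := exists_twin_leaves hinner (by simp [hG])
  obtain ⟨W, H, f, hf⟩ := exists_embedding_corona_of_leaves Set.sdiff_subset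
    (pairwiseDisjoint_leaves_diff_singleton hG.le hx hy hxy hxs hys)
  obtain ⟨q, rfl⟩ : x ∈ Set.range f := hf ▸ Or.inl ⟨hx, hxy⟩
  obtain ⟨p, rfl⟩ : s ∈ Set.range f := hf ▸ Or.inr ⟨f q, ⟨hx, hxy⟩, hxs⟩
  have hp : IsSupport (corona H) p := by
    have hqp := f.map_adj_iff.1 hxs
    exact ⟨q, hx.of_embedding f hqp, hqp⟩
  have hyf : y ∉ Set.range f := by
    rw [hf]
    rintro (h | ⟨l, ⟨hl, -⟩, hly⟩)
    · exact h.2 rfl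
    · obtain rfl := hy.eq_of_adj hys hly.symm
      exact hxy (IsLeaf.eq_of_adj hl hxs.symm hys.symm)
  obtain ⟨e, he⟩ := exists_embedding_addPendant f (s := p)
    (fun v => ⟨fun h => hy.eq_of_adj h hys, fun h => h ▸ hys⟩) hyf
  have hrange : Set.range e = G.support := by
    rw [he, hf]
    apply Set.Subset.antisymm
    · rintro v (rfl | ⟨hv, -⟩ | ⟨l, -, hlv⟩)
      exacts [hy.mem_support, IsLeaf.mem_support hv, ⟨l, hlv.symm⟩]
    · intro v hv
      rcases isLeaf_or_isSupport_of_inner_eq_empty hinner hv with hv | ⟨l, hl, hlv⟩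
      · exact or_iff_not_imp_left.2 fun hvy => Or.inl ⟨hv, hvy⟩
      · by_cases hly : l = y
        · obtain rfl := hy.eq_of_adj hys (hly ▸ hlv)
          exact Or.inr (Or.inr ⟨f q, ⟨hx, hxy⟩, hxs⟩)
        · exact Or.inr (Or.inr ⟨l, ⟨hl, hly⟩, hlv⟩)
  obtain ⟨k, hk⟩ := exists_iso_sum_bot e hrange
  exact ⟨_, _, k, Or.inr (Or.inr ⟨W, H, p, hp, ⟨Iso.refl⟩⟩), hk⟩

theorem IsJoinedPair.inner_of_diff_eq_singleton {G : SimpleGraph V} {a b d : V}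
    (h : IsJoinedPair G a b) (hG : shadowNumber G ≤ 2) (hD : inner G \ {a, b} = {d}) :
    (∀ r ∈ inner G, ∃ c, IsJoinedPair G r c) ∧ ∃ f : cycleGraph 3 ↪g G, Set.range f = inner G := by
  have hab := h.adj_of_diff_eq_singleton hG hD
  have hd : d ∈ inner G \ {a, b} := hD ▸ Set.mem_singleton d
  constructor
  · rw [h.inner_eq hD]
    rintro r ((rfl | rfl) | rfl)
    exacts [⟨b, h⟩, ⟨a, h.symm⟩, ⟨a, h.of_diff_eq_singleton hD hab⟩]
  · obtain ⟨f, hf⟩ :=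
      exists_embedding_cycleGraph_three hab (h.adj_right d hd).symm (h.adj_left d hd)
    exact ⟨f, by rw [hf, h.inner_eq hD, Set.insert_union, Set.singleton_union]⟩

theorem IsJoinedPair.inner_of_diff_eq_pair {G : SimpleGraph V} {a b d e : V}
    (h : IsJoinedPair G a b) (hmax : ∀ Z ⊆ inner G, IsEnclaveless G Z → Z.ncard ≤ 2)
    (hD : inner G \ {a, b} = {d, e}) (hde : d ≠ e) :
    (∀ r ∈ inner G, ∃ c, IsJoinedPair G r c) ∧ ∃ f : cycleGraph 4 ↪g G, Set.range f = inner G := by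
  have hd : d ∈ inner G \ {a, b} := hD ▸ Set.mem_insert d {e}
  have he : e ∈ inner G \ {a, b} := hD ▸ Set.mem_insert_of_mem d rfl
  have h' := h.of_diff_eq_pair hD hde
  constructor
  · rw [h.inner_eq hD]
    rintro r ((rfl | rfl) | rfl | rfl)
    exacts [⟨b, h⟩, ⟨a, h.symm⟩, ⟨e, h'⟩, ⟨d, h'.symm⟩]
  · obtain ⟨f, hf⟩ := exists_embedding_cycleGraph_four (h.adj_left d hd).symm (h.adj_right d hd)
      (h.adj_right e he).symm (h.adj_left e he) h.ne hde
      (h.not_adj_of_diff_eq_pair hmax hD hde)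
      (h'.not_adj_of_diff_eq_pair hmax (h.diff_eq_of_diff_eq_pair hD) h.ne)
    refine ⟨f, ?_⟩
    rw [hf, h.inner_eq hD, Set.insert_union, Set.singleton_union, Set.insert_comm d b]

theorem exists_isJoinedPair_and_cycleGraph_embedding [Finite V] {G : SimpleGraph V}
    (hG : shadowNumber G ≤ 2) (hne : (inner G).Nonempty) :
    (∀ r ∈ inner G, ∃ c, IsJoinedPair G r c) ∧
      ((∃ f : cycleGraph 3 ↪g G, Set.range f = inner G) ∨
        ∃ f : cycleGraph 4 ↪g G, Set.range f = inner G) := by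
  obtain ⟨a, b, h, hmax⟩ := exists_isJoinedPair hG hne
  obtain ⟨d, hD⟩ | ⟨d, e, hde, hD⟩ := h.diff_eq_singleton_or_pair hmax
  · exact (h.inner_of_diff_eq_singleton hG hD).imp_right Or.inl
  · exact (h.inner_of_diff_eq_pair hmax hD hde).imp_right Or.inr

theorem isC3OrC4OrDiadem_induce_range {G : SimpleGraph V} {R : Set V}
    (hR : (∃ f : cycleGraph 3 ↪g G, Set.range f = R) ∨ ∃ f : cycleGraph 4 ↪g G, Set.range f = R) :
    IsC3OrC4OrDiadem (G.induce R) := by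
  obtain ⟨f, rfl⟩ | ⟨f, rfl⟩ := hR
  · exact Or.inl ⟨f.isoInduceRange.symm⟩
  · exact Or.inr (Or.inl ⟨f.isoInduceRange.symm⟩)

theorem pairwiseDisjoint_leaves_of_inner_nonempty [Finite V] {G : SimpleGraph V}
    (hG : shadowNumber G ≤ 2) (hne : (inner G).Nonempty) :
    (leaves G).PairwiseDisjoint G.neighborSet := by
  obtain ⟨a, b, h, -⟩ := exists_isJoinedPair hG hne
  exact h.isInnerShadow.pairwiseDisjoint_leaves (Set.insert_nonempty a {b}) hG

theorem exists_iso_of_inner_nonempty [Finite V] {G : SimpleGraph V} (hG : shadowNumber G ≤ 2)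
    (hne : (inner G).Nonempty) :
    ∃ (B : Type u) (G₀ : SimpleGraph B) (W : Type u) (H : SimpleGraph W) (k : ℕ),
      IsC3OrC4OrDiadem G₀ ∧ Nonempty (G ≃g G₀ ⊕g corona H ⊕g (⊥ : SimpleGraph (Fin k))) := by
  obtain ⟨hpair, hcycle⟩ := exists_isJoinedPair_and_cycleGraph_embedding hG hne
  have not_adj {r s : V} (hr : r ∈ inner G) (hs : IsSupport G s) : ¬G.Adj r s :=
    let ⟨_, h⟩ := hpair r hr
    h.not_adj_of_isSupport hG hs
  obtain ⟨W, H, f, hf⟩ := exists_embedding_corona_of_leaves subset_rfl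
    (pairwiseDisjoint_leaves_of_inner_nonempty hG hne)
  have hleaf_or_support (x : W ⊕ W) : IsLeaf G (f x) ∨ IsSupport G (f x) :=
    hf.subset (Set.mem_range_self x)
  have hι : Set.range (Embedding.induce (G := G) (inner G)) = inner G := Subtype.range_val
  have hdisj : Disjoint (inner G) (Set.range f) := by
    rw [hf]
    exact Set.disjoint_left.2 fun r hr hr' => hr'.elim hr.2.1 hr.2.2
  obtain ⟨e, he⟩ := exists_embedding_sum (Embedding.induce (inner G)) f (hι.symm ▸ hdisj)
    fun r x hrx => (hleaf_or_support x).elim (fun hl => r.2.2.2 ⟨f x, hl, hrx.symm⟩)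
      fun hs => not_adj r.2 hs hrx
  have hrange : Set.range e = G.support := by
    rw [he, hf, hι]
    apply Set.Subset.antisymm
    · rintro v (hv | hv | hv)
      exacts [hv.1, IsLeaf.mem_support hv, IsSupport.mem_support hv]
    · intro v hv
      by_cases hv' : IsLeaf G v ∨ IsSupport G v
      · exact Or.inr hv'
      · exact Or.inl ⟨hv, not_or.1 hv'⟩
  obtain ⟨k, hk⟩ := exists_iso_sum_bot e hrange
  exact ⟨_, _, W, H, k, isC3OrC4OrDiadem_induce_range hcycle, hk⟩

end CertDom

theorem mainTheorem2 {V : Type u} [Fintype V] (G : SimpleGraph V) (hn : 3 ≤ Fintype.card V) :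
    CertDom.certDomNumber G = Fintype.card V - 2 ↔
      CertDom.IsC3OrC4OrDiadem G ∨
      (∃ (B : Type u) (G₀ : SimpleGraph B) (k : ℕ), CertDom.IsC3OrC4OrDiadem G₀ ∧
        Nonempty (G ≃g G₀ ⊕g (⊥ : SimpleGraph (Fin k)))) ∨
      (∃ (B : Type u) (G₀ : SimpleGraph B) (W : Type u) (H : SimpleGraph W) (k : ℕ),
        CertDom.IsC3OrC4OrDiadem G₀ ∧
        Nonempty (G ≃g G₀ ⊕g CertDom.corona H ⊕g (⊥ : SimpleGraph (Fin k)))) := by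
  rw [CertDom.certDomNumber_eq_card_sub_iff (k := 2) (by lia), Nat.cast_ofNat]
  constructor
  · intro hG
    obtain hinner | hinner := (CertDom.inner G).eq_empty_or_nonempty
    · exact Or.inr (Or.inl (CertDom.exists_iso_of_inner_eq_empty hG hinner))
    · exact Or.inr (Or.inr (CertDom.exists_iso_of_inner_nonempty hG.le hinner))
  · rintro (hG | ⟨B, G₀, k, hG₀, ⟨e⟩⟩ | ⟨B, G₀, W, H, k, hG₀, ⟨e⟩⟩)
    · exact hG.shadowNumber_eq_two
    · rw [CertDom.shadowNumber_congr e, CertDom.shadowNumber_sum, hG₀.shadowNumber_eq_two,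
        CertDom.shadowNumber_bot, add_zero]
    · rw [CertDom.shadowNumber_congr e, CertDom.shadowNumber_sum, CertDom.shadowNumber_sum,
        hG₀.shadowNumber_eq_two, CertDom.shadowNumber_corona, CertDom.shadowNumber_bot, add_zero,
        add_zero]
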